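/- Let \(n\ge 1\), let \(P\subseteq\mathbb R^n\) be a polytope, \(\|\cdot\|\) the Euclidean norm, and \(D>0\) an upper bound on the diameter of \(P\). For \(c,x\in\mathbb R^n\) write \(cx\) for the standard inner product. **Parameter.** A real number \(\mu\ge 1\) is called admissible (for \(P\) and \(D\)) if for all \(x,y\in P\) and every convex combination \(x=\sum_{i=1}^N\lambda_i v_i\) of the vertices \(v_1,\dots,v_N\) of \(P\) there are \(0\le\gamma_i\le\lambda_i\) and \(z\in P\) with \(x-y=\sum_i\gamma_i(v_i-z)\) and \(\sum_i\gamma_i\le\frac{\sqrt n\,\mu}{D}\|x-y\|\). **Oracle.** A weak separation oracle \(O\) for \(P\) takes \(c\in\mathbb R^n\), \(x\in P\), \(\Phi>0\), \(K\ge1\), and either returns a vertex \(y\) of \(P\) with \(c(x-y)>\Phi/K\), or returns **false**, in which case \(c(x-z)\le\Phi\) for all \(z\in P\). **Algorithm.** Given an admissible \(\mu\), an oracle \(O\), and \(c\in\mathbb R^n\), \(x\in P\), \(r>0\), \(\Phi>0\), \(K\ge 1\): 1. Put \(\Delta=\min\{\frac{\sqrt n\,\mu}{D}r,\,1\}\).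 2. Choose any decomposition \(x=\sum_{j=1}^M\lambda_jv_j\) into vertices of \(P\), with \(\lambda_j>0\) and \(\sum_j\lambda_j=1\), and any ordering \(i_1,\dots,i_M\) with \(cv_{i_1}\ge\dots\ge cv_{i_M}\). 3. Let \(k\) be the least index with \(\sum_{j=1}^k\lambda_{i_j}\ge\Delta\), and put \(p_-=\sum_{j=1}^{k-1}\lambda_{i_j}v_{i_j}+\bigl(\Delta-\sum_{j=1}^{k-1}\lambda_{i_j}\bigr)v_{i_k}\). 4. Call \(O(c,\,p_- /\Delta,\,\Phi/\Delta,\,K)\). If the answer is **false**, return **false**; if it is \(v^*\), return \(y=x-p_-+\Delta v^*\). **Claim.** (a) For every admissible \(\mu\), every weak separation oracle \(O\) and all inputs as above, the algorithm is correct: step 2 can be carried out, and whatever choices are made there, the algorithm - either returns \(y\in P\) with \(\|x-y\|\le\sqrt n\,\mu r\) and \(c(x-y)>\Phi/K\) (in particular \(c(x-y)\ge\Phi/K\)), - or returns **false**, and then \(c(x-z)\le\Phi\) for all \(z\in P\) with \(\|x-z\|\le r\). (b) Admissible parameters exist explicitly: if \(P\) has more than one point and \(P=\{x: A_1x=b_1,\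 A_2x\le b_2\}\), then \(\mu=\psi D/\xi\) is admissible, where \(\xi\) is the smallest positive value of \(b_2(j)-A_2(j)v\) over the vertices \(v\) of \(P\) and the rows \(A_2(j)\) of \(A_2\), and \(\psi\) is the largest spectral norm of a matrix formed by \(\operatorname{rank}A_2\) linearly independent rows of \(A_2\). -/

import Mathlib

namespace LazyCG

noncomputable section

/-- `ℝⁿ` with the `ℓ₂`-norm and the standard inner product. -/
abbrev E (n : ℕ) : Type := EuclideanSpace ℝ (Fin n)

/-- A polytope: the convex hull of finitely many points.  Its vertices are its extreme points
`P.extremePoints ℝ`. -/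
def IsPolytope {n : ℕ} (P : Set (E n)) : Prop :=
  ∃ S : Set (E n), S.Finite ∧ P = convexHull ℝ S

/-- A (global) weak separation oracle for `P`, called as `O c x Φ K`; the answer `none` is
"false".  The value of a linear objective `c` at `x` is the inner product of `c` and `x`. -/
def IsWeakSeparationOracle {n : ℕ} (P : Set (E n))
    (O : E n → E n → ℝ → ℝ → Option (E n)) : Prop :=
  ∀ (c x : E n) (Φ K : ℝ), x ∈ P → 0 < Φ → 1 ≤ K →
    (∀ y : E n, O c x Φ K = some y → y ∈ P.extremePoints ℝ ∧ Φ / K < inner ℝ c (x - y)) ∧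
    (O c x Φ K = none → ∀ z ∈ P, inner ℝ c (x - z) ≤ Φ)

/-- `μ ≥ 1` is an admissible parameter of `P` (relative to the bound `D` on the diameter): for
`x, y ∈ P` and every representation of `x` as a convex combination of the vertices of `P`, one
reaches `y` from `x` by moving a mass of at most `√n μ ‖x - y‖ / D` away from the vertices to a
single point `z ∈ P`. -/
def IsAdmissibleParameter {n : ℕ} (P : Set (E n)) (D μ : ℝ) : Prop :=
  1 ≤ μ ∧
  ∀ V : Finset (E n), (V : Set (E n)) = P.extremePoints ℝ →
  ∀ x ∈ P, ∀ y ∈ P, ∀ w : E n → ℝ,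
    (∀ v ∈ V, 0 ≤ w v) → ∑ v ∈ V, w v = 1 → ∑ v ∈ V, w v • v = x →
    ∃ (γ : E n → ℝ) (z : E n), z ∈ P ∧ (∀ v ∈ V, 0 ≤ γ v ∧ γ v ≤ w v) ∧
      x - y = ∑ v ∈ V, γ v • (v - z) ∧
      ∑ v ∈ V, γ v ≤ Real.sqrt n * μ / D * ‖x - y‖

/-! ### The explicit parameter `ψ D / ξ` of a linear description `A₁ x = b₁`, `A₂ x ≤ b₂` -/

/-- The set `{x | A₁ x = b₁, A₂ x ≤ b₂}`. -/
def solutionSet {n m₁ m₂ : ℕ} (A₁ : Matrix (Fin m₁) (Fin n) ℝ) (b₁ : Fin m₁ → ℝ)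
    (A₂ : Matrix (Fin m₂) (Fin n) ℝ) (b₂ : Fin m₂ → ℝ) : Set (E n) :=
  {x | (∀ i, ∑ l, A₁ i l * x l = b₁ i) ∧ (∀ j, ∑ l, A₂ j l * x l ≤ b₂ j)}

/-- `ξ`: the smallest positive slack of an inequality at a vertex of `P`. -/
def minSlack {n m₂ : ℕ} (P : Set (E n)) (A₂ : Matrix (Fin m₂) (Fin n) ℝ)
    (b₂ : Fin m₂ → ℝ) : ℝ :=
  sInf {s : ℝ | 0 < s ∧ ∃ v ∈ P.extremePoints ℝ, ∃ j, s = b₂ j - ∑ l, A₂ j l * v l}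

/-- `ψ`: the largest spectral norm of a matrix formed by `rank A₂` linearly independent rows
of `A₂`. -/
def maxBasisNorm {n m₂ : ℕ} (A₂ : Matrix (Fin m₂) (Fin n) ℝ) : ℝ :=
  sSup {t : ℝ | ∃ e : Fin A₂.rank → Fin m₂, LinearIndependent ℝ (fun i => A₂ (e i)) ∧
    t = ‖LinearMap.toContinuousLinearMap (Matrix.toEuclideanLin (A₂.submatrix e id))‖}

/-- The explicit parameter `μ = ψ D / ξ`. -/
def explicitParameter {n m₂ : ℕ} (P : Set (E n)) (D : ℝ) (A₂ : Matrix (Fin m₂) (Fin n) ℝ)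
    (b₂ : Fin m₂ → ℝ) : ℝ :=
  maxBasisNorm A₂ * D / minSlack P A₂ b₂

/-! ### The weak local separation algorithm -/

/-- A decomposition `x = ∑ λⱼ vⱼ` into vertices of `P`, with `λⱼ > 0` and `∑ λⱼ = 1`. -/
structure VertexDecomposition {n : ℕ} (P : Set (E n)) (x : E n) where
  M : ℕ
  wt : Fin M → ℝ
  vert : Fin M → E n
  wt_pos : ∀ j, 0 < wt j
  sum_wt : ∑ j, wt j = 1
  vert_mem : ∀ j, vert j ∈ P.extremePoints ℝ
  sum_smul : ∑ j, wt j • vert j = x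

/-- `Δ = min {√n μ r / D, 1}`. -/
def massBound (n : ℕ) (μ D r : ℝ) : ℝ := min (Real.sqrt n * μ / D * r) 1

/-- The least `k` such that the first `k` weights sum to at least `Δ`. -/
def cutIndex {M : ℕ} (w : Fin M → ℝ) (Δ : ℝ) : ℕ :=
  sInf {k : ℕ | Δ ≤ ∑ j ∈ Finset.univ.filter (fun j : Fin M => j.val < k), w j}

theorem cutIndex_pred_lt {M : ℕ} (w : Fin M → ℝ) (Δ : ℝ) (hw : ∑ j, w j = 1) (hΔ : Δ ≤ 1) :
    cutIndex w Δ - 1 < M := by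
  have hM : 0 < M := by
    rcases Nat.eq_zero_or_pos M with rfl | h
    · simp at hw
    · exact h
  have hk : cutIndex w Δ ≤ M := by
    apply Nat.sInf_le
    simpa [hw] using hΔ
  omega

/-- The point `p₋ = ∑_{j < k} λⱼ vⱼ + (Δ - ∑_{j < k} λⱼ) v_k`, where `k` is the cut index and
where `j` and `k` are counted from `1`. -/
def removedPart {n M : ℕ} (w : Fin M → ℝ) (v : Fin M → E n) (Δ : ℝ)
    (h : cutIndex w Δ - 1 < M) : E n :=
  (∑ j ∈ Finset.univ.filter (fun j : Fin M => j.val < cutIndex w Δ - 1), w j • v j) +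
    (Δ - ∑ j ∈ Finset.univ.filter (fun j : Fin M => j.val < cutIndex w Δ - 1), w j) • v ⟨cutIndex w Δ - 1, h⟩

theorem VertexDecomposition.sum_wt_perm {n : ℕ} {P : Set (E n)} {x : E n}
    (d : VertexDecomposition P x) (σ : Equiv.Perm (Fin d.M)) : ∑ j, d.wt (σ j) = 1 := by
  rw [Equiv.sum_comp σ d.wt, d.sum_wt]

/-- The result of the algorithm, for the decomposition `d` of `x` and the order `σ` of its
vertices; `none` is "false". -/
def weakLocalSeparation {n : ℕ} {P : Set (E n)} (O : E n → E n → ℝ → ℝ → Option (E n))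
    (D μ : ℝ) (c x : E n) (r Φ K : ℝ) (d : VertexDecomposition P x)
    (σ : Equiv.Perm (Fin d.M)) : Option (E n) :=
  let Δ : ℝ := massBound n μ D r
  let p : E n := removedPart (fun j => d.wt (σ j)) (fun j => d.vert (σ j)) Δ
    (cutIndex_pred_lt _ Δ (d.sum_wt_perm σ) (min_le_right _ _))
  match O c (Δ⁻¹ • p) (Φ / Δ) K with
  | none => none
  | some v => some (x - p + Δ • v)

/-- `out` is a possible result of the algorithm: it is obtained for some vertex decomposition of
`x` and some ordering of its vertices by non-increasing objective value. -/
def IsOutput {n : ℕ} (P : Set (E n)) (O : E n → E n → ℝ → ℝ → Option (E n))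
    (D μ : ℝ) (c x : E n) (r Φ K : ℝ) (out : Option (E n)) : Prop :=
  ∃ (d : VertexDecomposition P x) (σ : Equiv.Perm (Fin d.M)),
    Antitone (fun j => inner ℝ c (d.vert (σ j))) ∧
    out = weakLocalSeparation O D μ c x r Φ K d σ

end

end LazyCG

namespace LazyCG

open Finset Filter Topology

/-! ### Vertices of a polytope -/

/-! For (a), replacing the mass `Δ` of `p₋` by `v*` gives `x - y = Δ (p₋/Δ - v*)`: the distance is
at most `Δ D ≤ √n μ r`, and the factor `Δ` cancels the one in the oracle's threshold `Φ/Δ`. If the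
oracle says false and `‖x - z‖ ≤ r`, admissibility writes `x - z` as a transport of vertex mass `γ ≤
λ`, of total at most `Δ`, to a single point `z'`. The greedy mass `g` of `p₋` gains at least as much
relative to the cut value `f k` (`sum_greedy_mul_ge`), so the oracle's bound, used at `z'` or at the
cut vertex, bounds `c(x - z)`.

For (b), take a transport from `x` to `y` of least mass, with target `z`. If a vertex `u` losing
mass were tight at every constraint tight at `z`, then `z` could be pushed away from `u` inside `P`
and less mass would suffice (`exists_tight_of_min_transport`). So each such `u` has slack at least
`ξ` in some row of a maximal independent set `C` of rows tight at `z`. Slack in a row of `C`,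
weighted by `γ` and summed over the vertices, is `-A₂(j)(x - y)`. Hence `ξ ∑ γ` is at most the `ℓ₁`
norm of `x - y` under a row basis containing `C`, which is at most `√n ψ ‖x - y‖`. -/

theorem IsPolytope.convex {n : ℕ} {P : Set (E n)} (hP : IsPolytope P) : Convex ℝ P := by
  obtain ⟨S, -, rfl⟩ := hP
  exact convex_convexHull ℝ S

theorem IsPolytope.isCompact {n : ℕ} {P : Set (E n)} (hP : IsPolytope P) : IsCompact P := by
  obtain ⟨S, hS, rfl⟩ := hP
  exact hS.isCompact_convexHull ℝ

theorem IsPolytope.finite_extremePoints {n : ℕ} {P : Set (E n)} (hP : IsPolytope P) :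
    (P.extremePoints ℝ).Finite := by
  obtain ⟨S, hS, rfl⟩ := hP
  exact hS.subset extremePoints_convexHull_subset

/-- Krein–Milman; the closure is superfluous because the hull of finitely many points is closed. -/
theorem IsPolytope.convexHull_extremePoints {n : ℕ} {P : Set (E n)} (hP : IsPolytope P) :
    convexHull ℝ (P.extremePoints ℝ) = P := by
  have h := closure_convexHull_extremePoints hP.isCompact hP.convex
  rwa [(hP.finite_extremePoints.isClosed_convexHull ℝ).closure_eq] at h

theorem IsPolytope.exists_weights {n : ℕ} {P : Set (E n)} (hP : IsPolytope P)
    {V : Finset (E n)} (hV : (V : Set (E n)) = P.extremePoints ℝ) {x : E n} (hx : x ∈ P) :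
    ∃ w : E n → ℝ, (∀ v ∈ V, 0 ≤ w v) ∧ ∑ v ∈ V, w v = 1 ∧ ∑ v ∈ V, w v • v = x := by
  rw [← hP.convexHull_extremePoints, ← hV, Finset.mem_convexHull'] at hx
  exact hx

theorem IsPolytope.norm_sub_le {n : ℕ} {P : Set (E n)} (hP : IsPolytope P) {D : ℝ}
    (hdiam : Metric.diam P ≤ D) {x y : E n} (hx : x ∈ P) (hy : y ∈ P) : ‖x - y‖ ≤ D := by
  rw [← dist_eq_norm]
  exact (Metric.dist_le_diam_of_mem hP.isCompact.isBounded hx hy).trans hdiam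

theorem IsPolytope.nonempty_vertexDecomposition {n : ℕ} {P : Set (E n)} (hP : IsPolytope P)
    {x : E n} (hx : x ∈ P) : Nonempty (VertexDecomposition P x) := by
  classical
  set V : Finset (E n) := hP.finite_extremePoints.toFinset with hVdef
  have hV : (V : Set (E n)) = P.extremePoints ℝ := by simp [hVdef]
  obtain ⟨w, hw0, hw1, hwx⟩ := hP.exists_weights hV hx
  set U : Finset (E n) := V.filter (fun v => 0 < w v) with hU
  have hzero : ∀ v ∈ V, v ∉ U → w v = 0 := fun v hv hvU =>
    le_antisymm (not_lt.1 fun h => hvU (mem_filter.2 ⟨hv, h⟩)) (hw0 v hv)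
  let e := U.equivFin.symm
  refine ⟨⟨U.card, fun j => w (e j), fun j => (e j : E n), fun j => ?_, ?_, fun j => ?_, ?_⟩⟩
  · exact (mem_filter.1 (e j).2).2
  · rw [Equiv.sum_comp e (fun v : U => w v), Finset.sum_coe_sort U w, ← hw1]
    exact sum_subset (filter_subset _ _) hzero
  · rw [← hV]
    exact (mem_filter.1 (e j).2).1
  · rw [Equiv.sum_comp e (fun v : U => w v • (v : E n)), Finset.sum_coe_sort U fun v => w v • v,
      ← hwx]
    exact sum_subset (filter_subset _ _) fun v hv hvU => by rw [hzero v hv hvU, zero_smul]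

/-! ### The greedy weights -/

/-- The weights of `removedPart`: all of the mass before some index `k`, a part of the mass at
`k`, and nothing after `k`. -/
theorem exists_greedy_weights {n M : ℕ} (w : Fin M → ℝ) (v : Fin M → E n) {Δ : ℝ}
    (hw : ∀ j, 0 ≤ w j) (hw1 : ∑ j, w j = 1) (hΔ0 : 0 < Δ) (hΔ1 : Δ ≤ 1)
    (h : cutIndex w Δ - 1 < M) :
    ∃ (g : Fin M → ℝ) (k : Fin M), (∀ j, 0 ≤ g j) ∧ (∀ j, g j ≤ w j) ∧ ∑ j, g j = Δ ∧
      removedPart w v Δ h = ∑ j, g j • v j ∧ (∀ j < k, g j = w j) ∧ ∀ j, k < j → g j = 0 := by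
  set F : ℕ → ℝ := fun k => ∑ j ∈ univ.filter (fun j : Fin M => j.val < k), w j with hF
  have hne : {k : ℕ | Δ ≤ F k}.Nonempty := ⟨M, by simpa [hF, hw1] using hΔ1⟩
  have hmem : Δ ≤ F (cutIndex w Δ) := Nat.sInf_mem hne
  -- As `Δ > 0`, the truncated subtraction `cutIndex w Δ - 1` is a true predecessor.
  have hpos : 0 < cutIndex w Δ := by
    rcases Nat.eq_zero_or_pos (cutIndex w Δ) with h0 | h0
    · rw [h0] at hmem
      simp [hF] at hmem
      linarith
    · exact h0
  have hlt : F (cutIndex w Δ - 1) < Δ := by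
    by_contra hcon
    have := Nat.sInf_le (s := {k : ℕ | Δ ≤ F k}) (not_lt.1 hcon)
    change cutIndex w Δ ≤ _ at this
    omega
  set k : Fin M := ⟨cutIndex w Δ - 1, h⟩ with hk
  have hfil : univ.filter (fun j : Fin M => j.val < cutIndex w Δ) =
      insert k (univ.filter (fun j : Fin M => j.val < cutIndex w Δ - 1)) := by
    ext j
    simp only [mem_filter, mem_univ, true_and, mem_insert, hk, Fin.ext_iff]
    omega
  have hsucc : F (cutIndex w Δ) = w k + F (cutIndex w Δ - 1) := by
    simp only [hF]
    rw [hfil, sum_insert (by simp [hk])]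
  -- Stated for a general target so as to serve both the scalar masses and the vectors.
  have hsum : ∀ {X : Type} [AddCommMonoid X] (a b : Fin M → X),
      ∑ j, (if j < k then a j else if j = k then b j else 0) =
        ∑ j ∈ univ.filter (fun j : Fin M => j.val < cutIndex w Δ - 1), a j + b k := by
    intro X _ a b
    rw [← sum_filter_add_sum_filter_not univ (fun j : Fin M => j.val < cutIndex w Δ - 1)]
    congr 1
    · refine sum_congr rfl fun j hj => if_pos ?_
      exact (mem_filter.1 hj).2
    · rw [sum_eq_single k]
      · simp
      · intro j hj hjk
        rw [if_neg (by exact (mem_filter.1 hj).2), if_neg hjk]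
      · intro hk'
        rw [mem_filter, not_and, not_not] at hk'
        exact absurd (hk' (mem_univ k)) (lt_irrefl (cutIndex w Δ - 1))
  refine ⟨fun j => if j < k then w j else if j = k then Δ - F (cutIndex w Δ - 1) else 0, k,
    fun j => ?_, fun j => ?_, ?_, ?_, fun j hj => if_pos hj, fun j hj => ?_⟩
  · dsimp only
    split_ifs
    exacts [hw j, by linarith, le_rfl]
  · dsimp only
    split_ifs with h1 h2
    · exact le_rfl
    · subst h2
      linarith
    · exact hw j
  · rw [hsum w fun _ => Δ - F (cutIndex w Δ - 1)]
    simp only [hF]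
    ring
  · simp only [ite_smul, zero_smul]
    rw [hsum (fun j => w j • v j) fun j => (Δ - F (cutIndex w Δ - 1)) • v j]
    rfl
  · dsimp only
    rw [if_neg hj.not_gt, if_neg hj.ne']

/-- Termwise: before `k` the factor is nonnegative and `g` is full; after `k` the factor is
nonpositive and `g` vanishes. Total masses play no role. -/
theorem sum_greedy_mul_ge {M : ℕ} {w g γ f : Fin M → ℝ} {k : Fin M} (hf : Antitone f)
    (hγ0 : ∀ j, 0 ≤ γ j) (hγ : ∀ j, γ j ≤ w j) (hlt : ∀ j < k, g j = w j)
    (hgt : ∀ j, k < j → g j = 0) :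
    ∑ j, γ j * (f j - f k) ≤ ∑ j, g j * (f j - f k) := by
  refine sum_le_sum fun j _ => ?_
  rcases lt_trichotomy j k with h | h | h
  · rw [hlt j h]
    exact mul_le_mul_of_nonneg_right (hγ j) (sub_nonneg.2 (hf h.le))
  · simp [h]
  · rw [hgt j h, zero_mul]
    exact mul_nonpos_of_nonneg_of_nonpos (hγ0 j) (sub_nonpos.2 (hf h.le))

/-- Admissibility for a decomposition in which vertices may be repeated. -/
theorem IsAdmissibleParameter.exists_of_decomposition {n : ℕ} {P : Set (E n)} {D μ : ℝ}
    (hP : IsPolytope P) (hμ : IsAdmissibleParameter P D μ) {x y : E n} (hx : x ∈ P) (hy : y ∈ P)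
    {M : ℕ} (w : Fin M → ℝ) (v : Fin M → E n) (hw : ∀ j, 0 < w j) (hw1 : ∑ j, w j = 1)
    (hv : ∀ j, v j ∈ P.extremePoints ℝ) (hx' : ∑ j, w j • v j = x) :
    ∃ (γ : Fin M → ℝ) (z : E n), z ∈ P ∧ (∀ j, 0 ≤ γ j ∧ γ j ≤ w j) ∧
      x - y = ∑ j, γ j • (v j - z) ∧ ∑ j, γ j ≤ Real.sqrt n * μ / D * ‖x - y‖ := by
  classical
  set V : Finset (E n) := hP.finite_extremePoints.toFinset with hVdef
  have hV : (V : Set (E n)) = P.extremePoints ℝ := by simp [hVdef]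
  have hvV : ∀ j ∈ (univ : Finset (Fin M)), v j ∈ V := fun j _ => by
    rw [← mem_coe, hV]
    exact hv j
  set W : E n → ℝ := fun u => ∑ j ∈ univ.filter (fun j => v j = u), w j with hW
  obtain ⟨γ, z, hz, hγ, hxy, hsum⟩ := hμ.2 V hV x hx y hy W
    (fun u _ => sum_nonneg fun j _ => (hw j).le)
    (by rw [← hw1]; exact sum_fiberwise_of_maps_to hvV w)
    (by
      rw [← hx', ← sum_fiberwise_of_maps_to hvV]
      refine sum_congr rfl fun u _ => ?_
      rw [hW, sum_smul]
      exact sum_congr rfl fun j hj => by rw [(mem_filter.1 hj).2])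
  have hWpos : ∀ j, 0 < W (v j) := fun j =>
    sum_pos (fun i _ => hw i) ⟨j, by simp⟩
  have hfib : ∀ u ∈ V, ∑ j ∈ univ.filter (fun j => v j = u), γ (v j) / W (v j) * w j = γ u := by
    intro u hu
    have h1 : ∑ j ∈ univ.filter (fun j => v j = u), γ (v j) / W (v j) * w j
        = γ u / W u * W u := by
      rw [hW, mul_sum]
      exact sum_congr rfl fun j hj => by rw [(mem_filter.1 hj).2]
    rw [h1]
    -- If `W u = 0`, then `0 ≤ γ u ≤ W u` forces `γ u = 0`, in accord with division by zero.
    rcases eq_or_ne (W u) 0 with h0 | h0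
    · have := hγ u hu
      rw [h0] at this ⊢
      linarith
    · exact div_mul_cancel₀ _ h0
  -- The mass leaving a vertex is shared among its copies in proportion to their weights.
  refine ⟨fun j => γ (v j) / W (v j) * w j, z, hz, fun j => ⟨?_, ?_⟩, ?_, ?_⟩
  · exact mul_nonneg (div_nonneg (hγ _ (hvV j (mem_univ j))).1 (hWpos j).le) (hw j).le
  · exact mul_le_of_le_one_left (hw j).le
      ((div_le_one (hWpos j)).2 (hγ _ (hvV j (mem_univ j))).2)
  · rw [hxy, ← sum_fiberwise_of_maps_to hvV]
    refine sum_congr rfl fun u hu => ?_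
    rw [← hfib u hu, sum_smul]
    exact sum_congr rfl fun j hj => by simp only [(mem_filter.1 hj).2]
  · rw [← sum_fiberwise_of_maps_to hvV, sum_congr rfl hfib]
    exact hsum

/-! ### Correctness of the weak local separation algorithm -/

theorem massBound_pos {n : ℕ} (hn : 1 ≤ n) {μ D r : ℝ} (hμ : 1 ≤ μ) (hD : 0 < D) (hr : 0 < r) :
    0 < massBound n μ D r := by
  have : (0 : ℝ) < n := by exact_mod_cast hn
  unfold massBound
  positivity

theorem exists_isOutput {n : ℕ} {P : Set (E n)} (hP : IsPolytope P)
    (O : E n → E n → ℝ → ℝ → Option (E n)) (D μ : ℝ) (c : E n) {x : E n} (hx : x ∈ P)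
    (r Φ K : ℝ) : ∃ out, IsOutput P O D μ c x r Φ K out := by
  obtain ⟨d⟩ := hP.nonempty_vertexDecomposition hx
  -- The sign turns the increasing order of `Tuple.sort` into the required decreasing one.
  let f : Fin d.M → ℝ := fun j => -inner ℝ c (d.vert j)
  refine ⟨_, d, Tuple.sort f, fun i j hij => ?_, rfl⟩
  exact neg_le_neg_iff.1 (Tuple.monotone_sort f hij)

theorem isOutput_some {n : ℕ} (hn : 1 ≤ n) {P : Set (E n)} (hP : IsPolytope P) {D : ℝ}
    (hD : 0 < D) (hdiam : Metric.diam P ≤ D) {μ : ℝ} (hμ : 1 ≤ μ)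
    {O : E n → E n → ℝ → ℝ → Option (E n)} (hO : IsWeakSeparationOracle P O) {c x : E n}
    {r Φ K : ℝ} (hr : 0 < r) (hΦ : 0 < Φ) (hK : 1 ≤ K) {y : E n}
    (hy : IsOutput P O D μ c x r Φ K (some y)) :
    y ∈ P ∧ ‖x - y‖ ≤ Real.sqrt n * μ * r ∧ Φ / K < inner ℝ c (x - y) := by
  obtain ⟨d, σ, -, hout⟩ := hy
  have hΔ := massBound_pos hn hμ hD hr
  have hΔ1 : massBound n μ D r ≤ 1 := min_le_right _ _
  have hΔr : massBound n μ D r ≤ Real.sqrt n * μ / D * r := min_le_left _ _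
  unfold weakLocalSeparation at hout
  dsimp only at hout
  set Δ := massBound n μ D r
  have hsumx : ∑ j, d.wt (σ j) • d.vert (σ j) = x := by
    rw [Equiv.sum_comp σ fun j => d.wt j • d.vert j, d.sum_smul]
  obtain ⟨g, k, hg0, hgw, hgsum, hp, -, -⟩ := exists_greedy_weights (fun j => d.wt (σ j))
    (fun j => d.vert (σ j)) (fun j => (d.wt_pos _).le) (d.sum_wt_perm σ) hΔ hΔ1
    (cutIndex_pred_lt _ Δ (d.sum_wt_perm σ) hΔ1)
  set p := removedPart (fun j => d.wt (σ j)) (fun j => d.vert (σ j)) Δ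
    (cutIndex_pred_lt _ Δ (d.sum_wt_perm σ) hΔ1)
  have hvP : ∀ j, d.vert j ∈ P := fun j => (d.vert_mem j).1
  have hpP : Δ⁻¹ • p ∈ P := by
    rw [hp, smul_sum]
    simp only [smul_smul]
    refine hP.convex.sum_mem (fun j _ => mul_nonneg (inv_nonneg.2 hΔ.le) (hg0 j)) ?_
      fun j _ => hvP _
    rw [← mul_sum, hgsum, inv_mul_cancel₀ hΔ.ne']
  split at hout
  · cases hout
  · rename_i v hv
    obtain ⟨hvext, hval⟩ := (hO c (Δ⁻¹ • p) (Φ / Δ) K hpP (div_pos hΦ hΔ) hK).1 v hv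
    have hyv : y = x - p + Δ • v := Option.some.inj hout
    have hxy : x - y = Δ • (Δ⁻¹ • p - v) := by
      rw [hyv, smul_sub, smul_smul, mul_inv_cancel₀ hΔ.ne', one_smul]
      abel
    refine ⟨?_, ?_, ?_⟩
    · have hy' : y = ∑ j : Option (Fin d.M), (j.elim Δ fun j => d.wt (σ j) - g j) •
          (j.elim v fun j => d.vert (σ j)) := by
        rw [Fintype.sum_option]
        simp only [Option.elim, sub_smul, sum_sub_distrib]
        rw [hsumx, ← hp, hyv, add_comm]
      rw [hy']
      refine hP.convex.sum_mem ?_ ?_ ?_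
      · rintro (_ | j) -
        exacts [hΔ.le, sub_nonneg.2 (hgw j)]
      · rw [Fintype.sum_option]
        simp only [Option.elim, sum_sub_distrib]
        rw [d.sum_wt_perm σ, hgsum]
        ring
      · rintro (_ | j) -
        exacts [hvext.1, hvP _]
    · rw [hxy, norm_smul, Real.norm_of_nonneg hΔ.le]
      calc Δ * ‖Δ⁻¹ • p - v‖ ≤ (Real.sqrt n * μ / D * r) * D :=
            mul_le_mul hΔr (hP.norm_sub_le hdiam hpP hvext.1) (norm_nonneg _) (hΔ.le.trans hΔr)
        _ = Real.sqrt n * μ * r := by field_simp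
    · rw [hxy, real_inner_smul_right]
      calc Φ / K = Δ * (Φ / Δ / K) := by field_simp
        _ < _ := mul_lt_mul_of_pos_left hval hΔ

theorem isOutput_none {n : ℕ} (hn : 1 ≤ n) {P : Set (E n)} (hP : IsPolytope P) {D : ℝ}
    (hD : 0 < D) {μ : ℝ} (hμ : IsAdmissibleParameter P D μ)
    {O : E n → E n → ℝ → ℝ → Option (E n)} (hO : IsWeakSeparationOracle P O) {c x : E n}
    {r Φ K : ℝ} (hx : x ∈ P) (hr : 0 < r) (hΦ : 0 < Φ) (hK : 1 ≤ K)
    (hout : IsOutput P O D μ c x r Φ K none) {z : E n} (hz : z ∈ P) (hxz : ‖x - z‖ ≤ r) :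
    inner ℝ c (x - z) ≤ Φ := by
  obtain ⟨d, σ, hanti, hout⟩ := hout
  have hΔ := massBound_pos hn hμ.1 hD hr
  have hΔ1 : massBound n μ D r ≤ 1 := min_le_right _ _
  have hΔdef : massBound n μ D r = min (Real.sqrt n * μ / D * r) 1 := rfl
  unfold weakLocalSeparation at hout
  dsimp only at hout
  set Δ := massBound n μ D r
  have hsumx : ∑ j, d.wt (σ j) • d.vert (σ j) = x := by
    rw [Equiv.sum_comp σ fun j => d.wt j • d.vert j, d.sum_smul]
  obtain ⟨g, k, hg0, -, hgsum, hp, hlt, hgt⟩ := exists_greedy_weights (fun j => d.wt (σ j))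
    (fun j => d.vert (σ j)) (fun j => (d.wt_pos _).le) (d.sum_wt_perm σ) hΔ hΔ1
    (cutIndex_pred_lt _ Δ (d.sum_wt_perm σ) hΔ1)
  set p := removedPart (fun j => d.wt (σ j)) (fun j => d.vert (σ j)) Δ
    (cutIndex_pred_lt _ Δ (d.sum_wt_perm σ) hΔ1)
  have hvP : ∀ j, d.vert j ∈ P := fun j => (d.vert_mem j).1
  have hpP : Δ⁻¹ • p ∈ P := by
    rw [hp, smul_sum]
    simp only [smul_smul]
    refine hP.convex.sum_mem (fun j _ => mul_nonneg (inv_nonneg.2 hΔ.le) (hg0 j)) ?_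
      fun j _ => hvP _
    rw [← mul_sum, hgsum, inv_mul_cancel₀ hΔ.ne']
  split at hout
  swap
  · cases hout
  rename_i hnone
  set f : Fin d.M → ℝ := fun j => inner ℝ c (d.vert (σ j)) with hf
  have horacle : ∀ u ∈ P, ∑ j, g j * (f j - inner ℝ c u) ≤ Φ := by
    intro u hu
    have h1 := (hO c (Δ⁻¹ • p) (Φ / Δ) K hpP (div_pos hΦ hΔ) hK).2 hnone u hu
    have h2 : ∑ j, g j * (f j - inner ℝ c u) = Δ * inner ℝ c (Δ⁻¹ • p - u) := by
      rw [inner_sub_right, real_inner_smul_right, mul_sub, ← mul_assoc, mul_inv_cancel₀ hΔ.ne',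
        one_mul, hp, inner_sum]
      simp only [mul_sub, sum_sub_distrib, ← sum_mul, hgsum, real_inner_smul_right, hf]
    rw [h2]
    calc Δ * inner ℝ c (Δ⁻¹ • p - u) ≤ Δ * (Φ / Δ) := mul_le_mul_of_nonneg_left h1 hΔ.le
      _ = Φ := mul_div_cancel₀ _ hΔ.ne'
  obtain ⟨γ, z', hz', hγ, hxz', hγsum⟩ := hμ.exists_of_decomposition hP hx hz
    (fun j => d.wt (σ j)) (fun j => d.vert (σ j)) (fun j => d.wt_pos _) (d.sum_wt_perm σ)
    (fun j => d.vert_mem _) hsumx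
  -- The two terms of the minimum: admissibility with `‖x - z‖ ≤ r`, and `γ ≤ λ` with `∑ λ = 1`.
  have hγΔ : ∑ j, γ j ≤ Δ := by
    rw [hΔdef]
    refine le_min (hγsum.trans ?_) ?_
    · refine mul_le_mul_of_nonneg_left hxz ?_
      have := hμ.1
      positivity
    · rw [← d.sum_wt_perm σ]
      exact sum_le_sum fun j _ => (hγ j).2
  have hgreedy := sum_greedy_mul_ge hanti (fun j => (hγ j).1) (fun j => (hγ j).2) hlt hgt
  have hval : inner ℝ c (x - z) = ∑ j, γ j * (f j - inner ℝ c z') := by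
    rw [hxz', inner_sum]
    simp only [real_inner_smul_right, inner_sub_right, hf]
  rw [hval]
  -- If `z'` lies below the cut value, more mass moved to it means more gain, so `∑ γ ≤ Δ` helps.
  -- Otherwise replacing `z'` by the cut vertex only increases the gain, and no mass comparison is
  -- needed.
  rcases le_total (inner ℝ c z') (f k) with hle | hle
  · refine le_trans ?_ (horacle z' hz')
    have e1 : ∀ a : Fin d.M → ℝ, ∑ j, a j * (f j - inner ℝ c z') =
        ∑ j, a j * (f j - f k) + (∑ j, a j) * (f k - inner ℝ c z') := by
      intro a
      rw [sum_mul, ← sum_add_distrib]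
      exact sum_congr rfl fun j _ => by ring
    rw [e1, e1, hgsum]
    exact add_le_add hgreedy (mul_le_mul_of_nonneg_right hγΔ (sub_nonneg.2 hle))
  · refine le_trans ?_ (horacle _ (hvP (σ k)))
    refine le_trans (sum_le_sum fun j _ => ?_) hgreedy
    exact mul_le_mul_of_nonneg_left (by linarith) (hγ j).1

/-! ### The explicit parameter -/

/-- The linear form `x ↦ A(j) x` of a row of a matrix. -/
def rowForm {n m : ℕ} (A : Matrix (Fin m) (Fin n) ℝ) (j : Fin m) : E n →ₗ[ℝ] ℝ where
  toFun x := ∑ l, A j l * x l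
  map_add' x y := by simp [mul_add, sum_add_distrib]
  map_smul' t x := by
    simp only [PiLp.smul_apply, smul_eq_mul, RingHom.id_apply, mul_sum]
    exact sum_congr rfl fun l _ => by ring

theorem mem_solutionSet_iff {n m₁ m₂ : ℕ} {A₁ : Matrix (Fin m₁) (Fin n) ℝ} {b₁ : Fin m₁ → ℝ}
    {A₂ : Matrix (Fin m₂) (Fin n) ℝ} {b₂ : Fin m₂ → ℝ} {x : E n} :
    x ∈ solutionSet A₁ b₁ A₂ b₂ ↔
      (∀ i, rowForm A₁ i x = b₁ i) ∧ ∀ j, rowForm A₂ j x ≤ b₂ j := Iff.rfl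

/-- A point of a polyhedron can be moved a little in a direction that does not increase the
tight constraints. -/
theorem eventually_add_smul_mem_solutionSet {n m₁ m₂ : ℕ} {A₁ : Matrix (Fin m₁) (Fin n) ℝ}
    {b₁ : Fin m₁ → ℝ} {A₂ : Matrix (Fin m₂) (Fin n) ℝ} {b₂ : Fin m₂ → ℝ} {z h : E n}
    (hz : z ∈ solutionSet A₁ b₁ A₂ b₂) (h₁ : ∀ i, rowForm A₁ i h = 0)
    (h₂ : ∀ j, rowForm A₂ j z = b₂ j → rowForm A₂ j h ≤ 0) :
    ∀ᶠ t in 𝓝[>] (0 : ℝ), z + t • h ∈ solutionSet A₁ b₁ A₂ b₂ := by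
  have key : ∀ᶠ t in 𝓝[>] (0 : ℝ), ∀ j, rowForm A₂ j z + t * rowForm A₂ j h ≤ b₂ j := by
    rw [eventually_all]
    intro j
    rcases (hz.2 j).lt_or_eq with hlt | heq
    · have hcont : Continuous fun t : ℝ => rowForm A₂ j z + t * rowForm A₂ j h := by fun_prop
      have h0 : rowForm A₂ j z + 0 * rowForm A₂ j h < b₂ j := by
        rw [zero_mul, add_zero]
        exact hlt
      filter_upwards [nhdsWithin_le_nhds (hcont.continuousAt.eventually_lt continuousAt_const h0)]
        with t ht using ht.le
    · filter_upwards [self_mem_nhdsWithin] with t ht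
      have heq' : rowForm A₂ j z = b₂ j := heq
      have := mul_nonpos_of_nonneg_of_nonpos (le_of_lt (Set.mem_Ioi.1 ht)) (h₂ j heq')
      linarith
  filter_upwards [key] with t ht
  rw [mem_solutionSet_iff] at hz ⊢
  refine ⟨fun i => ?_, fun j => ?_⟩
  · rw [map_add, map_smul, h₁, smul_zero, add_zero, hz.1]
  · rw [map_add, map_smul, smul_eq_mul]
    exact ht j

/-! ### Row bases and the norm bound `ψ` -/

/-- A linearly independent family of rows extends to `rank A` linearly independent rows. -/
theorem exists_basis_rows {n m : ℕ} (A : Matrix (Fin m) (Fin n) ℝ) {C : Set (Fin m)}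
    (hC : LinearIndepOn ℝ (fun j => A j) C) :
    ∃ e : Fin A.rank → Fin m, LinearIndependent ℝ (fun i => A (e i)) ∧ C ⊆ Set.range e := by
  obtain ⟨B, -, hCB, hspan, hB⟩ := exists_linearIndepOn_extension hC (Set.subset_univ C)
  have hcard : Nat.card B = A.rank := by
    rw [Matrix.rank_eq_finrank_span_row]
    have h1 : Submodule.span ℝ (Set.range A.row) =
        Submodule.span ℝ ((fun j => A j) '' B) := by
      refine le_antisymm (Submodule.span_le.2 ?_) (Submodule.span_mono ?_)
      · rw [Set.image_univ] at hspan
        exact hspan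
      · exact Set.image_subset_range _ _
    rw [h1, Set.image_eq_range]
    classical
    have := Fintype.ofFinite B
    rw [Nat.card_eq_fintype_card]
    exact (finrank_span_eq_card hB).symm
  let e := (Finite.equivFinOfCardEq hcard).symm
  refine ⟨fun i => e i, hB.comp _ e.injective, fun j hj => ?_⟩
  exact ⟨e.symm ⟨j, hCB hj⟩, by simp⟩

theorem norm_basis_rows_le {n m : ℕ} (A : Matrix (Fin m) (Fin n) ℝ) {e : Fin A.rank → Fin m}
    (he : LinearIndependent ℝ (fun i => A (e i))) (h : E n) :
    ‖Matrix.toEuclideanLin (A.submatrix e id) h‖ ≤ maxBasisNorm A * ‖h‖ := by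
  have hle : ‖LinearMap.toContinuousLinearMap (Matrix.toEuclideanLin (A.submatrix e id))‖ ≤
      maxBasisNorm A := by
    -- Only finitely many row selections exist, so the supremum is not a default value.
    refine le_csSup (Set.Finite.bddAbove ?_) ⟨e, he, rfl⟩
    refine (Set.finite_range fun e : Fin A.rank → Fin m =>
      ‖LinearMap.toContinuousLinearMap (Matrix.toEuclideanLin (A.submatrix e id))‖).subset ?_
    rintro t ⟨e, -, rfl⟩
    exact ⟨e, rfl⟩
  exact (ContinuousLinearMap.le_opNorm _ h).trans
    (mul_le_mul_of_nonneg_right hle (norm_nonneg h))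

theorem toEuclideanLin_submatrix_apply {n m k : ℕ} (A : Matrix (Fin m) (Fin n) ℝ)
    (e : Fin k → Fin m) (h : E n) (i : Fin k) :
    Matrix.toEuclideanLin (A.submatrix e id) h i = rowForm A (e i) h := rfl

theorem abs_rowForm_le {n m : ℕ} (A : Matrix (Fin m) (Fin n) ℝ) {e : Fin A.rank → Fin m}
    (he : LinearIndependent ℝ (fun i => A (e i))) (i : Fin A.rank) (h : E n) :
    |rowForm A (e i) h| ≤ maxBasisNorm A * ‖h‖ := by
  rw [← toEuclideanLin_submatrix_apply, ← Real.norm_eq_abs]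
  exact (PiLp.norm_apply_le _ i).trans (norm_basis_rows_le A he h)

/-- Cauchy–Schwarz over `rank A ≤ n` coordinates; this is the source of the factor `√n`. -/
theorem sum_abs_rowForm_le {n m : ℕ} (A : Matrix (Fin m) (Fin n) ℝ) {e : Fin A.rank → Fin m}
    (he : LinearIndependent ℝ (fun i => A (e i))) (h : E n) :
    ∑ i, |rowForm A (e i) h| ≤ Real.sqrt n * (maxBasisNorm A * ‖h‖) := by
  set u := Matrix.toEuclideanLin (A.submatrix e id) h with hu
  have hrank : A.rank ≤ n := by simpa using A.rank_le_width
  have h1 : (∑ i, |u i|) ≤ Real.sqrt n * ‖u‖ := by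
    refine Real.le_sqrt_of_sq_le ?_ |>.trans_eq
      (show Real.sqrt (n * ‖u‖ ^ 2) = _ by
        rw [Real.sqrt_mul (Nat.cast_nonneg n), Real.sqrt_sq (norm_nonneg u)])
    calc (∑ i, |u i|) ^ 2 ≤ (Fintype.card (Fin A.rank) : ℝ) * ∑ i, |u i| ^ 2 :=
          sq_sum_le_card_mul_sum_sq
      _ ≤ n * ‖u‖ ^ 2 := by
          rw [EuclideanSpace.norm_sq_eq, Fintype.card_fin]
          simp only [Real.norm_eq_abs]
          exact mul_le_mul_of_nonneg_right (by exact_mod_cast hrank)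
            (sum_nonneg fun i _ => sq_nonneg _)
  exact h1.trans (mul_le_mul_of_nonneg_left (norm_basis_rows_le A he h) (Real.sqrt_nonneg _))

theorem rowForm_eq_zero_of_mem_span {n m : ℕ} (A : Matrix (Fin m) (Fin n) ℝ) {C : Set (Fin m)}
    {h : E n} (hC : ∀ j ∈ C, rowForm A j h = 0) {j : Fin m}
    (hj : A j ∈ Submodule.span ℝ ((fun j => A j) '' C)) : rowForm A j h = 0 := by
  change ∑ l, A j l * h l = 0
  refine Submodule.span_induction (p := fun a _ => ∑ l, a l * h l = 0) ?_ ?_ ?_ ?_ hj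
  · rintro _ ⟨i, hi, rfl⟩
    exact hC i hi
  · simp
  · intro a b _ _ ha hb
    simp only [Pi.add_apply, add_mul, sum_add_distrib, ha, hb, add_zero]
  · intro t a _ ha
    simp only [Pi.smul_apply, smul_eq_mul, mul_assoc, ← mul_sum, ha, mul_zero]

/-! ### The least slack `ξ` and the bound `ψ D / ξ ≥ 1` -/

theorem minSlack_le {n m₂ : ℕ} {P : Set (E n)} {A₂ : Matrix (Fin m₂) (Fin n) ℝ}
    {b₂ : Fin m₂ → ℝ} {v : E n} (hv : v ∈ P.extremePoints ℝ) {j : Fin m₂}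
    (hj : 0 < b₂ j - rowForm A₂ j v) : minSlack P A₂ b₂ ≤ b₂ j - rowForm A₂ j v :=
  csInf_le ⟨0, fun _ hs => hs.1.le⟩ ⟨hj, v, hv, j, rfl⟩

/-- A nonempty finite set attains its infimum; the given positive slack excludes the default `sInf ∅
= 0`. -/
theorem minSlack_pos {n m₂ : ℕ} {P : Set (E n)} (hP : IsPolytope P)
    {A₂ : Matrix (Fin m₂) (Fin n) ℝ} {b₂ : Fin m₂ → ℝ} {v : E n} (hv : v ∈ P.extremePoints ℝ)
    {j : Fin m₂} (hj : 0 < b₂ j - rowForm A₂ j v) : 0 < minSlack P A₂ b₂ := by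
  have hfin : {s : ℝ | 0 < s ∧ ∃ v ∈ P.extremePoints ℝ, ∃ j,
      s = b₂ j - ∑ l, A₂ j l * v l}.Finite := by
    refine ((hP.finite_extremePoints.prod (Set.finite_univ (α := Fin m₂))).image
      fun q => b₂ q.2 - ∑ l, A₂ q.2 l * q.1 l).subset ?_
    rintro s ⟨-, u, hu, i, rfl⟩
    exact ⟨(u, i), ⟨hu, Set.mem_univ i⟩, rfl⟩
  refine (Set.Nonempty.csInf_mem ?_ hfin).1
  exact ⟨_, hj, v, hv, j, rfl⟩

/-- Some constraint is tight at one vertex and slack at another. -/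
theorem exists_tight_and_slack {n m₁ m₂ : ℕ} {P : Set (E n)} (hP : IsPolytope P)
    (hnt : P.Nontrivial) {A₁ : Matrix (Fin m₁) (Fin n) ℝ} {b₁ : Fin m₁ → ℝ}
    {A₂ : Matrix (Fin m₂) (Fin n) ℝ} {b₂ : Fin m₂ → ℝ} (hPA : P = solutionSet A₁ b₁ A₂ b₂) :
    ∃ j, ∃ u ∈ P.extremePoints ℝ, ∃ v ∈ P.extremePoints ℝ,
      rowForm A₂ j v = b₂ j ∧ 0 < b₂ j - rowForm A₂ j u := by
  classical
  obtain ⟨u, hu⟩ := hP.isCompact.extremePoints_nonempty hnt.nonempty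
  obtain ⟨v, hv, hvu⟩ := hnt.exists_ne u
  have huP := hu.1
  -- Follow the ray from the vertex `u` through `v` to its last point `z` in `P`; some constraint
  -- tight there increases along the ray, hence is slack at `u`.
  set T : Set ℝ := (fun t : ℝ => u + t • (v - u)) ⁻¹' P with hT
  have hne : v - u ≠ 0 := sub_ne_zero.2 hvu
  have hTcompact : IsCompact T := by
    refine Metric.isCompact_of_isClosed_isBounded
      (hP.isCompact.isClosed.preimage (by fun_prop)) ?_
    obtain ⟨R, hR⟩ := hP.isCompact.isBounded.subset_closedBall u
    refine (Metric.isBounded_closedBall (x := (0 : ℝ)) (r := R / ‖v - u‖)).subset fun t ht => ?_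
    have h1 := hR ht
    rw [mem_closedBall_iff_norm, add_sub_cancel_left, norm_smul] at h1
    rw [mem_closedBall_zero_iff]
    exact (le_div_iff₀ (norm_pos_iff.2 hne)).2 h1
  have h1T : (1 : ℝ) ∈ T := by simpa [hT] using hv
  obtain ⟨t, htT, htmax⟩ := hTcompact.exists_isMaxOn ⟨1, h1T⟩ continuousOn_id
  have ht1 : (1 : ℝ) ≤ t := htmax h1T
  set z := u + t • (v - u) with hz
  have hzP : z ∈ P := htT
  have hmem : ∀ {a}, a ∈ P → (∀ i, rowForm A₁ i a = b₁ i) ∧ ∀ j, rowForm A₂ j a ≤ b₂ j :=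
    fun {a} ha => by rw [hPA] at ha; exact ha
  obtain ⟨j, hjz, hjd⟩ : ∃ j, rowForm A₂ j z = b₂ j ∧ 0 < rowForm A₂ j (v - u) := by
    by_contra! hcon
    have hev := eventually_add_smul_mem_solutionSet (h := v - u) (hPA ▸ hzP)
      (fun i => by rw [map_sub, (hmem hv).1, (hmem huP).1, sub_self]) hcon
    obtain ⟨s, hsP, hs⟩ := (hev.and self_mem_nhdsWithin).exists
    have hs0 : 0 < s := hs
    have : t + s ∈ T := by
      change u + (t + s) • (v - u) ∈ P
      rw [hPA, add_smul, ← add_assoc]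
      exact hsP
    have : t + s ≤ t := htmax this
    linarith
  have hju : 0 < b₂ j - rowForm A₂ j u := by
    rw [← hjz, hz, map_add, map_smul, smul_eq_mul, add_sub_cancel_left]
    exact mul_pos (by linarith) hjd
  set V : Finset (E n) := hP.finite_extremePoints.toFinset with hVdef
  have hV : (V : Set (E n)) = P.extremePoints ℝ := by simp [hVdef]
  obtain ⟨w, hw0, hw1, hwz⟩ := hP.exists_weights hV hzP
  -- An average of nonnegative slacks that vanishes: every vertex of positive weight in `z` is
  -- tight.
  have hsum : ∑ a ∈ V, w a * (b₂ j - rowForm A₂ j a) = 0 := by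
    have h1 : rowForm A₂ j z = ∑ a ∈ V, w a * rowForm A₂ j a := by
      rw [← hwz, map_sum]
      simp
    simp only [mul_sub, sum_sub_distrib]
    rw [← sum_mul, hw1, ← h1, hjz, one_mul, sub_self]
  have hVext : ∀ a ∈ V, a ∈ P.extremePoints ℝ := fun a ha => by rwa [← hV]
  have hall := (sum_eq_zero_iff_of_nonneg fun a ha =>
    mul_nonneg (hw0 a ha) (sub_nonneg.2 ((hmem (hVext a ha).1).2 j))).1 hsum
  obtain ⟨a, ha, hwa⟩ : ∃ a ∈ V, w a ≠ 0 := by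
    by_contra! hcon
    rw [sum_eq_zero hcon] at hw1
    exact zero_ne_one hw1
  refine ⟨j, u, hu, a, hVext a ha, ?_, hju⟩
  have := (mul_eq_zero.1 (hall a ha)).resolve_left hwa
  linarith

/-- For a row tight at `v` and slack at `u`, the slack `A₂(j)(v - u)` lies between `ξ` and `ψ D`. -/
theorem one_le_explicitParameter {n m₁ m₂ : ℕ} {P : Set (E n)} (hP : IsPolytope P) {D : ℝ}
    (hdiam : Metric.diam P ≤ D) (hnt : P.Nontrivial) {A₁ : Matrix (Fin m₁) (Fin n) ℝ}
    {b₁ : Fin m₁ → ℝ} {A₂ : Matrix (Fin m₂) (Fin n) ℝ} {b₂ : Fin m₂ → ℝ}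
    (hPA : P = solutionSet A₁ b₁ A₂ b₂) : 1 ≤ explicitParameter P D A₂ b₂ := by
  obtain ⟨j, u, hu, v, hv, hjv, hju⟩ := exists_tight_and_slack hP hnt hPA
  have hdiff : rowForm A₂ j (v - u) = b₂ j - rowForm A₂ j u := by rw [map_sub, hjv]
  have hrow : A₂ j ≠ 0 := by
    intro h0
    have : rowForm A₂ j (v - u) = 0 := by
      change ∑ l, A₂ j l * (v - u) l = 0
      simp [h0]
    linarith
  obtain ⟨e, he, hje⟩ := exists_basis_rows A₂ (C := {j}) (LinearIndepOn.singleton hrow)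
  obtain ⟨i, rfl⟩ := hje rfl
  rw [explicitParameter, le_div_iff₀ (minSlack_pos hP hu hju), one_mul]
  have h1 := abs_rowForm_le A₂ he i (v - u)
  have hψ : 0 ≤ maxBasisNorm A₂ := by
    refine Real.sSup_nonneg ?_
    rintro t ⟨e, -, rfl⟩
    exact norm_nonneg _
  calc minSlack P A₂ b₂ ≤ b₂ (e i) - rowForm A₂ (e i) u := minSlack_le hu hju
    _ ≤ |rowForm A₂ (e i) (v - u)| := hdiff ▸ le_abs_self _
    _ ≤ maxBasisNorm A₂ * ‖v - u‖ := h1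
    _ ≤ maxBasisNorm A₂ * D :=
        mul_le_mul_of_nonneg_left (hP.norm_sub_le hdiam hv.1 hu.1) hψ

/-! ### Least-mass transports and admissibility -/

/-- Among all ways to reach `y` from a convex combination `x` by moving mass to a single point
there is one that moves the least mass. -/
theorem exists_min_transport {n : ℕ} {P : Set (E n)} (hP : IsCompact P) {V : Finset (E n)}
    {x y : E n} (hy : y ∈ P) {w : E n → ℝ} (hw0 : ∀ v ∈ V, 0 ≤ w v) (hw1 : ∑ v ∈ V, w v = 1)
    (hwx : ∑ v ∈ V, w v • v = x) :
    ∃ (γ : E n → ℝ) (z : E n), z ∈ P ∧ (∀ v ∈ V, 0 ≤ γ v ∧ γ v ≤ w v) ∧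
      x - y = ∑ v ∈ V, γ v • (v - z) ∧
      ∀ (γ' : E n → ℝ) (z' : E n), z' ∈ P → (∀ v ∈ V, 0 ≤ γ' v ∧ γ' v ≤ w v) →
        x - y = ∑ v ∈ V, γ' v • (v - z') → ∑ v ∈ V, γ v ≤ ∑ v ∈ V, γ' v := by
  classical
  -- Forcing `γ` to vanish off `V` makes the feasible set compact in the product topology.
  set Q : Set ((E n → ℝ) × E n) :=
    ((Set.univ.pi fun v => Set.Icc 0 (if v ∈ V then w v else 0)) ×ˢ P) ∩
      {q | ∑ v ∈ V, q.1 v • (v - q.2) = x - y} with hQ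
  have hQc : IsCompact Q := by
    refine ((isCompact_univ_pi fun v => isCompact_Icc).prod hP).inter_right
      (isClosed_eq ?_ continuous_const)
    fun_prop
  have htrunc : ∀ (γ : E n → ℝ) (z : E n), z ∈ P → (∀ v ∈ V, 0 ≤ γ v ∧ γ v ≤ w v) →
      x - y = ∑ v ∈ V, γ v • (v - z) → ((fun v => if v ∈ V then γ v else 0), z) ∈ Q := by
    intro γ z hz hγ hxy
    refine ⟨⟨fun v _ => ?_, hz⟩, ?_⟩
    · dsimp only
      split_ifs with hv
      exacts [hγ v hv, ⟨le_rfl, le_rfl⟩]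
    · change ∑ v ∈ V, (if v ∈ V then γ v else 0) • (v - z) = x - y
      rw [hxy]
      exact sum_congr rfl fun v hv => by rw [if_pos hv]
  have hQne : Q.Nonempty := by
    -- Feasible: move all of the mass to `y`.
    refine ⟨_, htrunc w y hy (fun v hv => ⟨hw0 v hv, le_rfl⟩) ?_⟩
    simp only [smul_sub, sum_sub_distrib, ← sum_smul]
    rw [hwx, hw1, one_smul]
  obtain ⟨⟨γ, z⟩, ⟨⟨hγ, hz⟩, hxy⟩, hmin⟩ := hQc.exists_isMinOn hQne
    (f := fun q => ∑ v ∈ V, q.1 v) (by fun_prop)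
  refine ⟨γ, z, hz, fun v hv => ?_, hxy.symm, fun γ' z' hz' hγ' hxy' => ?_⟩
  · have := hγ v (Set.mem_univ v)
    dsimp only at this
    rw [if_pos hv] at this
    exact this
  · have h1 : ∑ v ∈ V, γ v ≤ ∑ v ∈ V, if v ∈ V then γ' v else 0 :=
      hmin (htrunc γ' z' hz' hγ' hxy')
    rwa [sum_congr rfl fun v hv => if_pos hv] at h1

/-- In a transport of least mass, each vertex from which mass is moved has positive slack at some
constraint that is tight at the target. -/
theorem exists_tight_of_min_transport {n m₁ m₂ : ℕ} {A₁ : Matrix (Fin m₁) (Fin n) ℝ}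
    {b₁ : Fin m₁ → ℝ} {A₂ : Matrix (Fin m₂) (Fin n) ℝ} {b₂ : Fin m₂ → ℝ} {V : Finset (E n)}
    (hV : ∀ v ∈ V, v ∈ solutionSet A₁ b₁ A₂ b₂) {h z : E n} {w γ : E n → ℝ}
    (hz : z ∈ solutionSet A₁ b₁ A₂ b₂) (hγ : ∀ v ∈ V, 0 ≤ γ v ∧ γ v ≤ w v)
    (hh : h = ∑ v ∈ V, γ v • (v - z))
    (hmin : ∀ (γ' : E n → ℝ) (z' : E n), z' ∈ solutionSet A₁ b₁ A₂ b₂ →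
      (∀ v ∈ V, 0 ≤ γ' v ∧ γ' v ≤ w v) → h = ∑ v ∈ V, γ' v • (v - z') →
      ∑ v ∈ V, γ v ≤ ∑ v ∈ V, γ' v) {u : E n} (hu : u ∈ V) (hγu : 0 < γ u) :
    ∃ j, rowForm A₂ j z = b₂ j ∧ rowForm A₂ j u ≠ b₂ j := by
  classical
  by_contra! hcon
  have hG : 0 < ∑ v ∈ V, γ v := sum_pos' (fun v hv => (hγ v hv).1) ⟨u, hu, hγu⟩
  set G := ∑ v ∈ V, γ v with hGdef
  have hev := eventually_add_smul_mem_solutionSet (h := z - u) hz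
    (fun i => by rw [map_sub, sub_eq_zero]; exact (hz.1 i).trans ((hV u hu).1 i).symm)
    (fun j hj => by rw [map_sub, hj, hcon j hj, sub_self])
  have hsmall : ∀ᶠ t in 𝓝[>] (0 : ℝ), t < γ u / G :=
    nhdsWithin_le_nhds (eventually_lt_nhds (div_pos hγu hG))
  obtain ⟨t, ⟨hzt, htG⟩, ht⟩ := ((hev.and hsmall).and self_mem_nhdsWithin).exists
  have ht0 : 0 < t := ht
  rw [lt_div_iff₀ hG] at htG
  -- Chosen so that `(G - δ)(1 + t) = G`: removing `δ` at `u` exactly offsets the shift of the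
  -- target to `z + t (z - u)`. Since `δ ≤ G t`, the bound on `t` keeps `δ ≤ γ u`.
  set δ := G * t / (1 + t) with hδ
  have hδ0 : 0 < δ := by positivity
  have hδu : δ ≤ γ u := by
    refine le_trans (div_le_self (by positivity) (by linarith)) ?_
    linarith
  have hδt : (G - δ) * (1 + t) = G := by
    rw [hδ]
    field_simp
    ring
  have hδt' : (G - δ) * t = δ := by linarith
  set γ' : E n → ℝ := fun v => γ v - if v = u then δ else 0 with hγ'
  have hsum' : ∑ v ∈ V, γ' v = G - δ := by
    simp only [hγ', sum_sub_distrib]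
    rw [sum_ite_eq' V u, if_pos hu]
  have h1 := hmin γ' (z + t • (z - u)) hzt (fun v hv => ?_) ?_
  · rw [hsum'] at h1
    linarith
  · simp only [hγ']
    split_ifs with hvu
    · subst hvu
      exact ⟨by linarith, by linarith [(hγ v hv).2]⟩
    · simpa using hγ v hv
  · have e1 : ∑ v ∈ V, γ' v • v = ∑ v ∈ V, γ v • v - δ • u := by
      simp only [hγ', sub_smul, sum_sub_distrib, ite_smul, zero_smul]
      rw [sum_ite_eq' V u, if_pos hu]
    simp only [smul_sub, sum_sub_distrib, ← sum_smul] at hh ⊢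
    rw [hh, e1, hsum', ← hGdef]
    have e2 : (G - δ) • (z + (t • z - t • u)) = G • z - δ • u := by
      calc (G - δ) • (z + (t • z - t • u))
          = ((G - δ) * (1 + t)) • z - ((G - δ) * t) • u := by module
        _ = _ := by rw [hδt, hδt']
    rw [e2]
    abel

theorem isAdmissibleParameter_explicitParameter {n m₁ m₂ : ℕ} {P : Set (E n)}
    (hP : IsPolytope P) {D : ℝ} (hD : 0 < D) (hdiam : Metric.diam P ≤ D) (hnt : P.Nontrivial)
    {A₁ : Matrix (Fin m₁) (Fin n) ℝ} {b₁ : Fin m₁ → ℝ} {A₂ : Matrix (Fin m₂) (Fin n) ℝ}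
    {b₂ : Fin m₂ → ℝ} (hPA : P = solutionSet A₁ b₁ A₂ b₂) :
    IsAdmissibleParameter P D (explicitParameter P D A₂ b₂) := by
  classical
  refine ⟨one_le_explicitParameter hP hdiam hnt hPA, fun V hV x hx y hy w hw0 hw1 hwx => ?_⟩
  have hξ : 0 < minSlack P A₂ b₂ := by
    obtain ⟨j, u, hu, -, -, -, hju⟩ := exists_tight_and_slack hP hnt hPA
    exact minSlack_pos hP hu hju
  obtain ⟨γ, z, hz, hγ, hxy, hmin⟩ := exists_min_transport hP.isCompact hy hw0 hw1 hwx
  refine ⟨γ, z, hz, hγ, hxy, ?_⟩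
  have hVext : ∀ v ∈ V, v ∈ P.extremePoints ℝ := fun v hv => by rwa [← hV]
  have hVP : ∀ v ∈ V, v ∈ solutionSet A₁ b₁ A₂ b₂ := fun v hv => hPA ▸ (hVext v hv).1
  have htight : ∀ u ∈ V, 0 < γ u → ∃ j, rowForm A₂ j z = b₂ j ∧ rowForm A₂ j u ≠ b₂ j :=
    fun u hu hγu => exists_tight_of_min_transport hVP (hPA ▸ hz) hγ hxy
      (by rw [← hPA]; exact hmin) hu hγu
  -- `C` is independent and spans all rows tight at `z`, so a vertex tight on `C` is tight at all of
  -- them.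
  obtain ⟨C, hCT, -, hspan, hC⟩ := exists_linearIndepOn_extension
    (linearIndepOn_empty ℝ (fun j => A₂ j)) (Set.empty_subset {j | rowForm A₂ j z = b₂ j})
  obtain ⟨e, he, hCe⟩ := exists_basis_rows A₂ hC
  have hslack : ∀ u ∈ V, ∀ j, 0 ≤ b₂ j - rowForm A₂ j u := fun u hu j =>
    sub_nonneg.2 ((hVP u hu).2 j)
  have hone : ∀ u ∈ V, γ u * minSlack P A₂ b₂ ≤
      γ u * ∑ i ∈ univ.filter (fun i => e i ∈ C), (b₂ (e i) - rowForm A₂ (e i) u) := by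
    intro u hu
    rcases (hγ u hu).1.eq_or_lt with h0 | h0
    · rw [← h0, zero_mul, zero_mul]
    refine mul_le_mul_of_nonneg_left ?_ h0.le
    obtain ⟨j, hj, hju⟩ : ∃ j ∈ C, rowForm A₂ j u ≠ b₂ j := by
      by_contra! hcon
      obtain ⟨j, hjz, hju⟩ := htight u hu h0
      have h1 : rowForm A₂ j (u - z) = 0 := by
        refine rowForm_eq_zero_of_mem_span A₂ (C := C) (fun i hi => ?_) (hspan ⟨j, hjz, rfl⟩)
        rw [map_sub, hcon i hi, hCT hi, sub_self]
      rw [map_sub, hjz, sub_eq_zero] at h1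
      exact hju h1
    obtain ⟨i, rfl⟩ := hCe hj
    have hpos : 0 < b₂ (e i) - rowForm A₂ (e i) u :=
      lt_of_le_of_ne (hslack u hu _) (Ne.symm (sub_ne_zero.2 hju.symm))
    exact (minSlack_le (hVext u hu) hpos).trans
      (single_le_sum (f := fun i => b₂ (e i) - rowForm A₂ (e i) u)
        (fun i _ => hslack u hu _) (mem_filter.2 ⟨mem_univ i, hj⟩))
  have hrow : ∀ i ∈ univ.filter (fun i => e i ∈ C),
      ∑ u ∈ V, γ u * (b₂ (e i) - rowForm A₂ (e i) u) ≤ |rowForm A₂ (e i) (x - y)| := by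
    intro i hi
    have htz : rowForm A₂ (e i) z = b₂ (e i) := hCT (mem_filter.1 hi).2
    -- Tightness at `z` turns each slack into `A₂(e i)(z - u)`, and these sum to the displacement.
    have h1 : ∑ u ∈ V, γ u * (b₂ (e i) - rowForm A₂ (e i) u) = -rowForm A₂ (e i) (x - y) := by
      rw [hxy, map_sum, ← sum_neg_distrib]
      refine sum_congr rfl fun u _ => ?_
      rw [map_smul, map_sub, htz, smul_eq_mul]
      ring
    rw [h1]
    exact neg_le_abs _
  have hbound : (∑ u ∈ V, γ u) * minSlack P A₂ b₂ ≤
      Real.sqrt n * (maxBasisNorm A₂ * ‖x - y‖) := by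
    calc (∑ u ∈ V, γ u) * minSlack P A₂ b₂
        ≤ ∑ u ∈ V, γ u * ∑ i ∈ univ.filter (fun i => e i ∈ C),
            (b₂ (e i) - rowForm A₂ (e i) u) := by
          rw [sum_mul]
          exact sum_le_sum hone
      _ = ∑ i ∈ univ.filter (fun i => e i ∈ C),
            ∑ u ∈ V, γ u * (b₂ (e i) - rowForm A₂ (e i) u) := by
          simp only [mul_sum]
          exact sum_comm
      _ ≤ ∑ i ∈ univ.filter (fun i => e i ∈ C), |rowForm A₂ (e i) (x - y)| := sum_le_sum hrow
      _ ≤ ∑ i, |rowForm A₂ (e i) (x - y)| :=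
          sum_le_sum_of_subset_of_nonneg (filter_subset _ _) fun i _ _ => abs_nonneg _
      _ ≤ _ := sum_abs_rowForm_le A₂ he (x - y)
  calc ∑ u ∈ V, γ u ≤ Real.sqrt n * (maxBasisNorm A₂ * ‖x - y‖) / minSlack P A₂ b₂ :=
        (le_div_iff₀ hξ).2 hbound
    _ = Real.sqrt n * explicitParameter P D A₂ b₂ / D * ‖x - y‖ := by
        rw [explicitParameter]
        field_simp

end LazyCG

theorem mainTheorem4 {n : ℕ} (hn : 1 ≤ n) (P : Set (LazyCG.E n)) (hP : LazyCG.IsPolytope P)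
    (D : ℝ) (hD : 0 < D) (hdiam : Metric.diam P ≤ D) :
    (∀ μ : ℝ, LazyCG.IsAdmissibleParameter P D μ →
      ∀ O : LazyCG.E n → LazyCG.E n → ℝ → ℝ → Option (LazyCG.E n),
      LazyCG.IsWeakSeparationOracle P O →
      ∀ (c x : LazyCG.E n) (r Φ K : ℝ), x ∈ P → 0 < r → 0 < Φ → 1 ≤ K →
        (∃ out, LazyCG.IsOutput P O D μ c x r Φ K out) ∧
        (∀ y, LazyCG.IsOutput P O D μ c x r Φ K (some y) →
          y ∈ P ∧ ‖x - y‖ ≤ Real.sqrt n * μ * r ∧ Φ / K < inner ℝ c (x - y)) ∧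
        (LazyCG.IsOutput P O D μ c x r Φ K none →
          ∀ z ∈ P ∩ Metric.closedBall x r, inner ℝ c (x - z) ≤ Φ)) ∧
    (P.Nontrivial →
      ∀ (m₁ m₂ : ℕ) (A₁ : Matrix (Fin m₁) (Fin n) ℝ) (b₁ : Fin m₁ → ℝ)
        (A₂ : Matrix (Fin m₂) (Fin n) ℝ) (b₂ : Fin m₂ → ℝ),
        P = LazyCG.solutionSet A₁ b₁ A₂ b₂ →
        LazyCG.IsAdmissibleParameter P D (LazyCG.explicitParameter P D A₂ b₂)) := by
  refine ⟨fun μ hμ O hO c x r Φ K hx hr hΦ hK => ⟨?_, fun y hy => ?_, fun hout z hz => ?_⟩,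
    fun hnt m₁ m₂ A₁ b₁ A₂ b₂ hPA => ?_⟩
  · exact LazyCG.exists_isOutput hP O D μ c hx r Φ K
  · exact LazyCG.isOutput_some hn hP hD hdiam hμ.1 hO hr hΦ hK hy
  · exact LazyCG.isOutput_none hn hP hD hμ hO hx hr hΦ hK hout hz.1
      (by rw [← dist_eq_norm, dist_comm]; exact hz.2)
  · exact LazyCG.isAdmissibleParameter_explicitParameter hP hD hdiam hnt hPA
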